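/- Let $k\ge 3$ be an integer. There exist a constant $c>0$ and an integer $n_0$, both depending only on $k$, such that the following holds for every $n\ge n_0$. For a finite simple graph $G$, let $q(G)$ be the largest eigenvalue of its signless Laplacian matrix $Q(G)=D(G)+A(G)$, where $D(G)$ is the diagonal matrix of vertex degrees and $A(G)$ is the adjacency matrix. Let $T_{n,k}$ be the Turán graph, that is, the complete $k$-partite graph on $n$ vertices whose part sizes are as equal as possible. If $G$ is an $n$-vertex graph with $$q(G)\ge q(T_{n,k}),$$ then either $G$ is isomorphic to $T_{n,k}$, or there is an integer $t\ge cn$ such that $G$ contains, as a (not necessarily induced) subgraph, a copy of the generalized book $B_{k,t}=K_k\vee I_t$, the graph obtained by joining every vertex of a clique on $k$ vertices to every vertex of an independent set of size $t$. -/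

import Mathlib

namespace SignlessBook

/-- The signless Laplacian matrix `Q(G) = D(G) + A(G)`, with real entries. -/
def signlessLaplacian {V : Type*} [Fintype V] [DecidableEq V]
    (G : SimpleGraph V) [DecidableRel G.Adj] : Matrix V V ℝ :=
  G.degMatrix ℝ + G.adjMatrix ℝ

/-- The signless Laplacian spectral radius `q(G)`: the largest eigenvalue of `Q(G)`. The supremum
is attained as soon as `G` has a vertex, see `isGreatest_signlessRadius`. -/
noncomputable def signlessRadius {V : Type*} [Fintype V] [DecidableEq V]
    (G : SimpleGraph V) [DecidableRel G.Adj] : ℝ :=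
  sSup {μ : ℝ | Module.End.HasEigenvalue (Matrix.toLin' (signlessLaplacian G)) μ}

theorem isGreatest_signlessRadius {V : Type*} [Fintype V] [DecidableEq V] [Nonempty V]
    (G : SimpleGraph V) [DecidableRel G.Adj] :
    IsGreatest {μ : ℝ | Module.End.HasEigenvalue (Matrix.toLin' (signlessLaplacian G)) μ}
      (signlessRadius G) := by
  have hQ : (signlessLaplacian G).IsHermitian := by
    refine Matrix.IsHermitian.add ?_ ?_
    · exact Matrix.isHermitian_diagonal_of_self_adjoint _ (by
        ext i
        simp)
    · ext i j
      simp [SimpleGraph.adj_comm]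
  have hfin : {μ : ℝ | Module.End.HasEigenvalue
      (Matrix.toLin' (signlessLaplacian G)) μ}.Finite :=
    Module.End.finite_hasEigenvalue _
  have hne : {μ : ℝ | Module.End.HasEigenvalue
      (Matrix.toLin' (signlessLaplacian G)) μ}.Nonempty := by
    obtain ⟨i⟩ := ‹Nonempty V›
    refine ⟨hQ.eigenvalues i, ?_⟩
    have h := hQ.eigenvalues_mem_spectrum_real i
    rw [← Matrix.spectrum_toLin'] at h
    exact Module.End.hasEigenvalue_iff_mem_spectrum.mpr h
  exact ⟨hne.csSup_mem hfin, fun μ hμ => le_csSup hfin.bddAbove hμ⟩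

/-- The generalized book `B_{k,t} = K_k ∨ I_t`: a clique on `Fin k`, an independent set `Fin t`,
and all edges between the two. -/
def generalizedBook (k t : ℕ) : SimpleGraph (Fin k ⊕ Fin t) :=
  ((⊤ : SimpleGraph (Fin k)) ⊕g (⊥ : SimpleGraph (Fin t))) ⊔ completeBipartiteGraph (Fin k) (Fin t)

end SignlessBook

namespace SignlessBook

open Finset Matrix

section Spectral

variable {V : Type*} [Fintype V] [DecidableEq V] (G : SimpleGraph V) [DecidableRel G.Adj]

theorem signlessLaplacian_mulVec_apply (x : V → ℝ) (v : V) :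
    (signlessLaplacian G *ᵥ x) v = G.degree v * x v + ∑ w ∈ G.neighborFinset v, x w := by
  rw [signlessLaplacian, Matrix.add_mulVec, Pi.add_apply, SimpleGraph.degMatrix_mulVec_apply,
    SimpleGraph.adjMatrix_mulVec_apply]

theorem isHermitian_signlessLaplacian : (signlessLaplacian G).IsHermitian :=
  (G.isHermitian_degMatrix ℝ).add (by ext i j; simp [SimpleGraph.adj_comm])

theorem posSemidef_radius_sub [Nonempty V] :
    (Matrix.diagonal (fun _ => signlessRadius G) - signlessLaplacian G).PosSemidef := by
  have hH : (Matrix.diagonal (fun _ => signlessRadius G) - signlessLaplacian G).IsHermitian :=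
    (Matrix.isHermitian_diagonal _).sub (isHermitian_signlessLaplacian G)
  rw [hH.posSemidef_iff_eigenvalues_nonneg]
  intro i
  have h := hH.eigenvalues_mem_spectrum_real i
  rw [← Matrix.spectrum_toLin', ← Module.End.hasEigenvalue_iff_mem_spectrum] at h
  obtain ⟨x, hx⟩ := h.exists_hasEigenvector
  have h1 := hx.apply_eq_smul
  rw [Matrix.toLin'_apply, Matrix.sub_mulVec] at h1
  have h2 : Module.End.HasEigenvector (Matrix.toLin' (signlessLaplacian G))
      (signlessRadius G - hH.eigenvalues i) x := by
    refine ⟨Module.End.mem_eigenspace_iff.2 ?_, hx.2⟩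
    rw [Matrix.toLin'_apply]
    ext v
    have := congrFun h1 v
    simp only [Pi.sub_apply, Matrix.mulVec_diagonal, Pi.smul_apply, smul_eq_mul] at this ⊢
    linarith
  have := (isGreatest_signlessRadius G).2 (Module.End.hasEigenvalue_of_hasEigenvector h2)
  simpa using this

theorem rayleigh_le [Nonempty V] (y : V → ℝ) :
    ∑ v, (G.degree v * y v ^ 2 + y v * ∑ w ∈ G.neighborFinset v, y w)
      ≤ signlessRadius G * ∑ v, y v ^ 2 := by
  have h := (posSemidef_radius_sub G).dotProduct_mulVec_nonneg y
  rw [Matrix.sub_mulVec, dotProduct_sub] at h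
  simp only [dotProduct, star_trivial, Matrix.mulVec_diagonal, signlessLaplacian_mulVec_apply] at h
  rw [sub_nonneg] at h
  rw [mul_sum]
  exact (sum_congr rfl fun v _ => by ring).trans_le
    (h.trans (sum_congr rfl fun v _ => by ring).le)

theorem exists_nonneg_eigenvector [Nonempty V] :
    ∃ x : V → ℝ, (∀ v, 0 ≤ x v) ∧ x ≠ 0 ∧
      ∀ v, (signlessRadius G - G.degree v) * x v = ∑ w ∈ G.neighborFinset v, x w := by
  obtain ⟨z, hz⟩ := (isGreatest_signlessRadius G).1.exists_hasEigenvector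
  have hz1 := hz.apply_eq_smul
  rw [Matrix.toLin'_apply] at hz1
  have hzv : ∀ v, G.degree v * z v + ∑ w ∈ G.neighborFinset v, z w = signlessRadius G * z v := by
    intro v
    have := congrFun hz1 v
    rwa [signlessLaplacian_mulVec_apply] at this
  let x : V → ℝ := fun v => |z v|
  have hP := posSemidef_radius_sub G
  have hle : ∑ v, signlessRadius G * z v ^ 2
      ≤ ∑ v, (G.degree v * x v ^ 2 + x v * ∑ w ∈ G.neighborFinset v, x w) := by
    refine sum_le_sum fun v _ => ?_
    have h1 : signlessRadius G * z v ^ 2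
        = G.degree v * z v ^ 2 + z v * ∑ w ∈ G.neighborFinset v, z w := by
      have := hzv v
      linear_combination (- z v) * this
    rw [h1]
    have h2 : z v * ∑ w ∈ G.neighborFinset v, z w ≤ |z v| * ∑ w ∈ G.neighborFinset v, |z w| :=
      (le_abs_self _).trans (by rw [abs_mul]; gcongr; exact abs_sum_le_sum_abs _ _)
    have h3 : x v ^ 2 = z v ^ 2 := sq_abs _
    rw [h3]
    simp only [x]
    linarith
  have h0 : star x ⬝ᵥ ((Matrix.diagonal (fun _ => signlessRadius G) - signlessLaplacian G) *ᵥ x)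
      = 0 := by
    refine le_antisymm ?_ (hP.dotProduct_mulVec_nonneg x)
    rw [Matrix.sub_mulVec, dotProduct_sub]
    simp only [dotProduct, star_trivial, Matrix.mulVec_diagonal, signlessLaplacian_mulVec_apply]
    rw [sub_nonpos]
    refine (sum_congr rfl fun v _ => ?_).trans_le
      (hle.trans (sum_congr rfl fun v _ => by ring).le)
    have h3 : x v ^ 2 = z v ^ 2 := sq_abs _
    rw [← h3]
    ring
  rw [hP.dotProduct_mulVec_zero_iff] at h0
  refine ⟨x, fun v => abs_nonneg _, fun h => hz.2 ?_, fun v => ?_⟩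
  · ext v
    have := congrFun h v
    simpa [x] using this
  · have := congrFun h0 v
    rw [Matrix.sub_mulVec, Pi.sub_apply, Matrix.mulVec_diagonal, signlessLaplacian_mulVec_apply]
      at this
    simp only [Pi.zero_apply] at this
    linarith

end Spectral

section Restriction

variable {V : Type*} (G : SimpleGraph V)

/-- The spanning subgraph of `G` whose edges are those inside `S`. -/
def restr (S : Finset V) : SimpleGraph V where
  Adj u v := u ∈ S ∧ v ∈ S ∧ G.Adj u v
  symm := ⟨fun _ _ h => ⟨h.2.1, h.1, h.2.2.symm⟩⟩
  loopless := ⟨fun _ h => G.irrefl h.2.2⟩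

variable {G} in
@[simp] theorem restr_adj {S : Finset V} {u v : V} :
    (restr G S).Adj u v ↔ u ∈ S ∧ v ∈ S ∧ G.Adj u v := Iff.rfl

variable [DecidableRel G.Adj]

/-- The neighbours of `v` inside `S`. -/
def nb (S : Finset V) (v : V) : Finset V := S.filter (G.Adj v)

variable {G} in
@[simp] theorem mem_nb {S : Finset V} {v w : V} : w ∈ nb G S v ↔ w ∈ S ∧ G.Adj v w := by
  simp [nb]

variable {G} in
theorem nb_subset (S : Finset V) (v : V) : nb G S v ⊆ S := filter_subset _ _

variable {G} in
theorem card_nb_le (S : Finset V) (v : V) : #(nb G S v) ≤ #S := card_le_card (nb_subset S v)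

variable [DecidableEq V]

instance (S : Finset V) : DecidableRel (restr G S).Adj :=
  fun u v => inferInstanceAs (Decidable (u ∈ S ∧ v ∈ S ∧ G.Adj u v))

variable {G}

variable [Fintype V]

theorem neighborFinset_restr {S : Finset V} {v : V} (hv : v ∈ S) :
    (restr G S).neighborFinset v = nb G S v := by
  ext w
  simp [hv]

theorem neighborFinset_restr_of_notMem {S : Finset V} {v : V} (hv : v ∉ S) :
    (restr G S).neighborFinset v = ∅ := by
  ext w
  simp [hv]

variable (G) in
/-- The signless Laplacian radius of the subgraph of `G` induced on `S`. -/
noncomputable def rad (S : Finset V) : ℝ := signlessRadius (restr G S)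

theorem rad_univ : rad G univ = signlessRadius G := by
  have h : restr G univ = G := by ext u v; simp
  unfold rad
  congr!

theorem rayleigh_rad_le [Nonempty V] (S : Finset V) (y : V → ℝ) :
    ∑ v ∈ S, (#(nb G S v) * y v ^ 2 + y v * ∑ w ∈ nb G S v, y w)
      ≤ rad G S * ∑ v ∈ S, y v ^ 2 := by
  have h := rayleigh_le (restr G S) (fun v => if v ∈ S then y v else 0)
  rw [← sum_subset (subset_univ S), ← sum_subset (subset_univ S)] at h
  · unfold rad
    refine le_trans (le_of_eq ?_) (h.trans (le_of_eq ?_))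
    · refine sum_congr rfl fun v hv => ?_
      rw [← SimpleGraph.card_neighborFinset_eq_degree, neighborFinset_restr hv, if_pos hv]
      congr 2
      exact sum_congr rfl fun w hw => (if_pos (nb_subset S v hw)).symm
    · congr 1
      exact sum_congr rfl fun w hw => by rw [if_pos hw]
  · intro v _ hv
    simp [hv]
  · intro v _ hv
    simp [hv]

theorem exists_rad_eigenvector [Nonempty V] {S : Finset V} (hq : 0 < rad G S) :
    ∃ x : V → ℝ, (∀ v, 0 ≤ x v) ∧ ∑ v ∈ S, x v ^ 2 = 1 ∧
      ∀ v ∈ S, (rad G S - #(nb G S v)) * x v = ∑ w ∈ nb G S v, x w := by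
  obtain ⟨x, hx0, hx, he⟩ := exists_nonneg_eigenvector (restr G S)
  have hout : ∀ v ∉ S, x v = 0 := by
    intro v hv
    have := he v
    rw [← SimpleGraph.card_neighborFinset_eq_degree, neighborFinset_restr_of_notMem hv] at this
    simp only [card_empty, Nat.cast_zero, sub_zero, sum_empty] at this
    exact (mul_eq_zero.1 this).resolve_left hq.ne'
  have hpos : 0 < ∑ v ∈ S, x v ^ 2 := by
    obtain ⟨v, hv⟩ := Function.ne_iff.1 hx
    have hvS : v ∈ S := by
      by_contra h
      exact hv (hout v h)
    refine sum_pos' (fun _ _ => sq_nonneg _) ⟨v, hvS, ?_⟩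
    have : x v ≠ 0 := hv
    positivity
  set N := ∑ v ∈ S, x v ^ 2 with hN
  have hs : 0 < √N := Real.sqrt_pos.2 hpos
  refine ⟨fun v => x v / √N, fun v => div_nonneg (hx0 v) hs.le, ?_, fun v hv => ?_⟩
  · simp only [div_pow]
    rw [← sum_div, Real.sq_sqrt hpos.le, ← hN, div_self hpos.ne']
  · have := he v
    rw [← SimpleGraph.card_neighborFinset_eq_degree, neighborFinset_restr hv] at this
    rw [← sum_div, ← this]
    unfold rad
    ring

theorem rad_le_two_mul_card [Nonempty V] (S : Finset V) : rad G S ≤ 2 * #S := by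
  by_contra! hlt
  have hq : 0 < rad G S := lt_of_le_of_lt (by positivity) hlt
  obtain ⟨x, hx0, hx, he⟩ := exists_rad_eigenvector hq
  have hne : S.Nonempty := by
    rw [nonempty_iff_ne_empty]
    rintro rfl
    simp at hx
  obtain ⟨u, hu, hmax⟩ := S.exists_max_image x hne
  have hxu : 0 < x u := by
    refine (hx0 u).lt_of_ne fun h => ?_
    have : ∑ v ∈ S, x v ^ 2 = 0 := sum_eq_zero fun v hv => by
      have := hmax v hv
      have := hx0 v
      have : x v = 0 := by linarith
      simp [this]
    linarith
  have h1 : ∑ w ∈ nb G S u, x w ≤ #(nb G S u) * x u := by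
    rw [← nsmul_eq_mul]
    exact sum_le_card_nsmul _ _ _ fun w hw => hmax w (nb_subset S u hw)
  have h2 : (#(nb G S u) : ℝ) ≤ #S := by exact_mod_cast card_nb_le S u
  have h3 := he u hu
  nlinarith

end Restriction

section Deletion

variable {V : Type*} [Fintype V] [DecidableEq V] {G : SimpleGraph V} [DecidableRel G.Adj]

theorem rayleigh_erase [Nonempty V] {S : Finset V} {u : V} (hu : u ∈ S) {q : ℝ} {x : V → ℝ}
    (hx : ∑ v ∈ S, x v ^ 2 = 1)
    (he : ∀ v ∈ S, (q - #(nb G S v)) * x v = ∑ w ∈ nb G S v, x w) :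
    q - (2 * q - #(nb G S u)) * x u ^ 2 - ∑ v ∈ nb G S u, x v ^ 2
      ≤ rad G (S.erase u) * (1 - x u ^ 2) := by
  have h := rayleigh_rad_le (G := G) (S.erase u) x
  have hsum : ∀ f : V → ℝ, ∑ v ∈ S.erase u, f v = ∑ v ∈ S, f v - f u := fun f => by
    rw [← add_sum_erase S f hu]; ring
  have hnb : ∀ v ∈ S.erase u, (#(nb G (S.erase u) v) : ℝ) * x v ^ 2
      + x v * ∑ w ∈ nb G (S.erase u) v, x w
      = q * x v ^ 2 - if G.Adj u v then x v ^ 2 + x u * x v else 0 := by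
    intro v hv
    have hvS := mem_of_mem_erase hv
    have hev := he v hvS
    have heq : nb G (S.erase u) v = (nb G S v).erase u := by
      ext w; simp [and_assoc]
    rw [heq]
    split_ifs with hadj
    · have hmem : u ∈ nb G S v := mem_nb.2 ⟨hu, hadj.symm⟩
      rw [← add_sum_erase _ x hmem] at hev
      have hc : (#((nb G S v).erase u) : ℝ) + 1 = #(nb G S v) := by
        exact_mod_cast card_erase_add_one hmem
      rw [← hc] at hev
      linear_combination -(x v) * hev
    · have hmem : u ∉ nb G S v := fun h => hadj (mem_nb.1 h).2.symm
      rw [erase_eq_of_notMem hmem]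
      linear_combination -(x v) * hev
  rw [sum_congr rfl hnb, sum_sub_distrib, ← mul_sum, hsum, hsum, hx, ← sum_filter,
    if_neg (G.irrefl (v := u)), sum_add_distrib, ← mul_sum] at h
  change _ - (∑ v ∈ nb G S u, x v ^ 2 + x u * ∑ v ∈ nb G S u, x v - 0) ≤ _ at h
  rw [← he u hu] at h
  linarith

theorem exists_erase_rad_ge [Nonempty V] {S : Finset V} {ε : ℝ} (hε : 0 < ε) (hε1 : ε ≤ 1 / 2)
    (hm : 16 / ε ≤ #S) (hq : 5 / 4 * #S ≤ rad G S)
    (hδ : ∃ w ∈ S, 2 * (#(nb G S w) : ℝ) ≤ rad G S - 2 * ε * #S) :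
    ∃ u ∈ S, rad G S * (1 - 1 / #S) + ε / 8 ≤ rad G (S.erase u) := by
  obtain ⟨w, hw, hwδ⟩ := hδ
  have hm0 : (0 : ℝ) < #S := lt_of_lt_of_le (by positivity) hm
  have hq0 : 0 < rad G S := lt_of_lt_of_le (by positivity) hq
  have hq2 := rad_le_two_mul_card (G := G) S
  obtain ⟨x, hx0, hx, he⟩ := exists_rad_eigenvector hq0
  obtain ⟨u, hu, hmin⟩ := S.exists_min_image x ⟨w, hw⟩
  have hray := rayleigh_erase hu hx he
  refine ⟨u, hu, ?_⟩
  have hcompl : ∀ v ∈ S, ∑ z ∈ nb G S v, x z ^ 2 ≤ 1 - (#S - #(nb G S v)) * x u ^ 2 := by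
    intro v _
    have h1 := sum_sdiff (f := fun z => x z ^ 2) (nb_subset (G := G) S v)
    have h2 : (#(S \ nb G S v) : ℝ) * x u ^ 2 ≤ ∑ z ∈ S \ nb G S v, x z ^ 2 := by
      rw [← nsmul_eq_mul]
      exact card_nsmul_le_sum _ _ _ fun z hz =>
        pow_le_pow_left₀ (hx0 u) (hmin z (mem_sdiff.1 hz).1) 2
    rw [cast_card_sdiff (nb_subset S v)] at h2
    simp only [hx] at h1
    linarith
  have hδm : (#(nb G S w) : ℝ) ≤ #S := by exact_mod_cast card_nb_le S w
  set m : ℝ := (#S : ℝ)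
  set q := rad G S
  have hcs : (q - #(nb G S w)) ^ 2 * x w ^ 2
      ≤ #(nb G S w) * (1 - (m - #(nb G S w)) * x u ^ 2) := by
    rw [← mul_pow, he w hw]
    exact sq_sum_le_card_mul_sum_sq.trans (by gcongr; exact hcompl w hw)
  have hδ0 : (0 : ℝ) ≤ #(nb G S w) := by positivity
  have hxw : x u ^ 2 ≤ x w ^ 2 := pow_le_pow_left₀ (hx0 u) (hmin w hw) 2
  have hu1 := hcompl u hu
  set δ : ℝ := (#(nb G S w) : ℝ)
  set d : ℝ := (#(nb G S u) : ℝ)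
  set a := x u ^ 2
  have ha0 : 0 ≤ a := sq_nonneg _
  clear_value a d δ q m
  have h1 : a * (q * (q - 2 * δ) + δ * m) ≤ δ := by
    have := mul_le_mul_of_nonneg_left hxw (sq_nonneg (q - δ))
    linarith
  have h2 : 2 * ε * m * m ≤ q * (q - 2 * δ) := by
    have : 2 * ε * m ≤ q - 2 * δ := by linarith
    calc 2 * ε * m * m = m * (2 * ε * m) := by ring
      _ ≤ q * (q - 2 * δ) := by gcongr; linarith
  have h3 : a * (2 * ε * m * m + δ * m) ≤ δ :=
    le_trans (mul_le_mul_of_nonneg_left (by linarith) ha0) h1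
  have h4 : m * a * (1 + 2 * ε) ≤ 1 := by
    have h5 : m * a ≤ 1 := by
      by_contra! hlt
      have : δ < m * a * δ ∨ δ = 0 := by
        rcases hδ0.eq_or_lt with h | h
        · exact Or.inr h.symm
        · exact Or.inl (by nlinarith)
      have h6 : 0 < (m * a) * (2 * ε * m) := by positivity
      rcases this with h | h <;> nlinarith
    have h7 : m * (m * a * (2 * ε)) ≤ δ * (1 - m * a) := by linarith
    have h8 : m * (m * a * (2 * ε)) ≤ m * (1 - m * a) :=
      h7.trans (mul_le_mul_of_nonneg_right hδm (by linarith))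
    have := le_of_mul_le_mul_left h8 hm0
    linarith
  have h5 : m * a ≤ 1 - ε := by
    have : (1 - ε) * (1 + 2 * ε) ≥ 1 := by nlinarith
    have h6 : m * a * (1 + 2 * ε) ≤ (1 - ε) * (1 + 2 * ε) := by linarith
    exact le_of_mul_le_mul_right h6 (by linarith)
  have hm1 : (1 : ℝ) ≤ m := by
    refine le_trans ?_ hm
    rw [le_div_iff₀ hε]; linarith
  have ha1 : a < 1 := by nlinarith
  have h6 : q - (2 * q - d) * a - (1 - (m - d) * a) ≤ rad G (S.erase u) * (1 - a) := by linarith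
  have h7 : (q * (1 - 1 / m) + ε / 8) * (1 - a) ≤ rad G (S.erase u) * (1 - a) := by
    refine le_trans ?_ h6
    have hqm : q / m ≤ 2 := by rw [div_le_iff₀ hm0]; linarith
    have hqm' : 5 / 4 ≤ q / m := by rw [le_div_iff₀ hm0]; linarith
    have hmε : 1 / m ≤ ε / 16 := by
      rw [div_le_div_iff₀ hm0 (by norm_num)]
      rw [div_le_iff₀ hε] at hm
      linarith
    have hqa : q * a = (q / m) * (m * a) := by field_simp
    have e1 : q * (1 - 1 / m) = q - q / m := by field_simp
    have hX : (q / m) * a ≤ ε / 8 := by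
      have : a = (m * a) * (1 / m) := by field_simp
      rw [this]
      have hma : 0 ≤ m * a := by positivity
      have : (m * a) * (1 / m) ≤ 1 * (ε / 16) := by gcongr; linarith
      calc q / m * (m * a * (1 / m)) ≤ 2 * (1 * (ε / 16)) := by gcongr
        _ = ε / 8 := by ring
    rw [e1]
    have key : ε / 4 ≤ (1 - m * a) * (q / m - 1) := by
      calc ε / 4 = ε * (1 / 4) := by ring
        _ ≤ (1 - m * a) * (q / m - 1) := by gcongr <;> linarith
    have hεa : 0 ≤ ε / 8 * a := by positivity
    nlinarith
  exact le_of_mul_le_mul_right h7 (by linarith)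

/-- Deleting vertices of small degree one at a time ends with a vertex set of large minimum degree,
or with a very small one; the quantity `rad / #S + (ε / 8) * log #S` does not decrease. -/
theorem exists_subset_large_minDegree [Nonempty V] {ε : ℝ} (hε : 0 < ε) (hε1 : ε ≤ 1 / 2)
    (S : Finset V) (hS : S.Nonempty) (hq : 5 / 4 ≤ rad G S / #S) :
    ∃ T ⊆ S, T.Nonempty ∧
      rad G S / #S + ε / 8 * Real.log #S ≤ rad G T / #T + ε / 8 * Real.log #T ∧
      rad G S / #S ≤ rad G T / #T ∧
      (T = S ∨ rad G S / #S + ε / (8 * #S) ≤ rad G T / #T) ∧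
      ((#T : ℝ) < 16 / ε ∨ ∀ w ∈ T, rad G T - 2 * ε * #T < 2 * (#(nb G T w) : ℝ)) := by
  induction S using Finset.strongInduction with
  | H S ih =>
    by_cases hterm : (#S : ℝ) < 16 / ε ∨ ∀ w ∈ S, rad G S - 2 * ε * #S < 2 * (#(nb G S w) : ℝ)
    · exact ⟨S, subset_rfl, hS, le_rfl, le_rfl, Or.inl rfl, hterm⟩
    push Not at hterm
    have hm0 : (0 : ℝ) < #S := by exact_mod_cast hS.card_pos
    have hm32 : (32 : ℝ) ≤ #S := by
      refine le_trans ?_ hterm.1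
      rw [le_div_iff₀ hε]; linarith
    have hq' : 5 / 4 * #S ≤ rad G S := (le_div_iff₀ hm0).1 hq
    obtain ⟨u, hu, hur⟩ := exists_erase_rad_ge hε hε1 hterm.1 hq' hterm.2
    have hc : (#(S.erase u) : ℝ) = #S - 1 := by
      rw [card_erase_of_mem hu, Nat.cast_sub hS.card_pos, Nat.cast_one]
    have hc0 : (0 : ℝ) < #(S.erase u) := by rw [hc]; linarith
    have hstep : rad G S / #S + ε / (8 * #(S.erase u)) ≤ rad G (S.erase u) / #(S.erase u) := by
      rw [le_div_iff₀ hc0]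
      refine le_trans (le_of_eq ?_) hur
      have hne := hc0.ne'
      rw [add_mul, hc]
      rw [hc] at hne
      field_simp
    have hpos : 0 < ε / (8 * #(S.erase u)) := by positivity
    have hmono : rad G S / #S ≤ rad G (S.erase u) / #(S.erase u) := by linarith
    have hlog : Real.log #S - Real.log #(S.erase u) ≤ 1 / #(S.erase u) := by
      rw [← Real.log_div hm0.ne' hc0.ne']
      refine (Real.log_le_sub_one_of_pos (by positivity)).trans (le_of_eq ?_)
      rw [div_sub_one hc0.ne', hc]
      ring
    have hle : ε / (8 * #S) ≤ ε / (8 * #(S.erase u)) := by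
      gcongr
      exact erase_subset _ _
    obtain ⟨T, hTS, hT, h1, h2, -, h4⟩ := ih (S.erase u) (erase_ssubset hu)
      (card_pos.1 (by exact_mod_cast hc0)) (hq.trans hmono)
    refine ⟨T, hTS.trans (erase_subset _ _), hT, ?_, hmono.trans h2, Or.inr ?_, h4⟩
    · have : ε / 8 * (Real.log #S - Real.log #(S.erase u)) ≤ ε / 8 * (1 / #(S.erase u)) := by
        gcongr
      have e : ε / 8 * (1 / #(S.erase u)) = ε / (8 * #(S.erase u)) := by
        field_simp
      linarith
    · linarith

end Deletion

section Structure

variable {V : Type*} {G : SimpleGraph V} [DecidableRel G.Adj]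

variable (G) in
/-- The common neighbours inside `S` of the vertices in `B`. -/
def cnb (S B : Finset V) : Finset V := S.filter fun w => ∀ v ∈ B, G.Adj v w

@[simp] theorem mem_cnb {S B : Finset V} {w : V} :
    w ∈ cnb G S B ↔ w ∈ S ∧ ∀ v ∈ B, G.Adj v w := by
  simp [cnb]

theorem cnb_mono {S T : Finset V} (h : S ⊆ T) (B : Finset V) : cnb G S B ⊆ cnb G T B :=
  filter_subset_filter _ h

theorem cnb_empty (S : Finset V) : cnb G S ∅ = S := by
  ext; simp

variable [DecidableEq V]

theorem cnb_insert (S B : Finset V) (u : V) :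
    cnb G S (insert u B) = cnb G S B \ (S \ nb G S u) := by
  ext w
  simp only [mem_cnb, mem_insert, forall_eq_or_imp, mem_sdiff, mem_nb]
  tauto

theorem card_cnb_insert_ge (S B : Finset V) (u : V) :
    (#(cnb G S B) : ℝ) - #(S \ nb G S u) ≤ #(cnb G S (insert u B)) := by
  rw [cnb_insert, sub_le_iff_le_add]
  exact_mod_cast card_le_card_sdiff_add_card

theorem card_cnb_ge {S : Finset V} {b : ℝ} (hb : ∀ u ∈ S, (#(S \ nb G S u) : ℝ) ≤ b)
    {B : Finset V} (hB : B ⊆ S) : (#S : ℝ) - #B * b ≤ #(cnb G S B) := by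
  induction B using Finset.induction_on with
  | empty => simp [cnb_empty]
  | insert u B hu ih =>
    have h1 := ih ((subset_insert u B).trans hB)
    have h2 := card_cnb_insert_ge (G := G) S B u
    have h3 := hb u (hB (mem_insert_self u B))
    rw [card_insert_of_notMem hu]
    push_cast
    linarith

theorem isNClique_insert_of_mem_cnb {S B : Finset V} {j : ℕ} (hB : G.IsNClique j B) {w : V}
    (hw : w ∈ cnb G S B) : G.IsNClique (j + 1) (insert w B) :=
  hB.insert fun v hv => ((mem_cnb.1 hw).2 v hv).symm

/-- A set of minimum degree above `(1 - 1 / (k - 1)) * #S` contains a `k`-clique. -/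
theorem exists_isNClique {S : Finset V} {b : ℝ} (hb : ∀ u ∈ S, (#(S \ nb G S u) : ℝ) ≤ b)
    (hb0 : 0 ≤ b) {k : ℕ} (hk : ((k : ℝ) - 1) * b < #S) :
    ∃ B ⊆ S, G.IsNClique k B := by
  induction k with
  | zero => exact ⟨∅, by simp, by simp⟩
  | succ j ih =>
    push_cast at hk
    obtain ⟨B, hBS, hB⟩ := ih (by nlinarith)
    have h := card_cnb_ge hb hBS
    rw [hB.card_eq] at h
    have hpos : 0 < #(cnb G S B) := by
      have : (0 : ℝ) < #(cnb G S B) := by linarith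
      exact_mod_cast this
    obtain ⟨w, hw⟩ := card_pos.1 hpos
    exact ⟨insert w B, insert_subset (mem_cnb.1 hw).1 hBS, isNClique_insert_of_mem_cnb hB hw⟩

/-- Greedy embedding: if the sets `M i` are almost completely joined to each other and no
`k`-clique has `τ` common neighbours, then no clique has many common neighbours in all of the
`M i`, `i ∈ J`, when `J` is large. -/
theorem exists_few_common_neighbors {ι : Type*} [DecidableEq ι] {S : Finset V} {k : ℕ}
    {τ ρ : ℝ} (hτ : 0 < τ) (hρ : 0 ≤ ρ)
    (hbook : ∀ B ⊆ S, G.IsNClique k B → (#(cnb G S B) : ℝ) < τ)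
    {M : ι → Finset V} (hMS : ∀ i, M i ⊆ S)
    (hM : ∀ i j, i ≠ j → ∀ w ∈ M i, (#(M j \ nb G (M j) w) : ℝ) ≤ ρ)
    {J : Finset ι} (hJ : J.Nonempty) {B : Finset V} (hBS : B ⊆ S) {b : ℕ} (hB : G.IsNClique b B)
    (hcard : b + #J = k + 1) :
    ∃ j ∈ J, (#(cnb G (M j) B) : ℝ) < #J * ρ + τ := by
  induction J using Finset.induction_on generalizing B b with
  | empty => simp at hJ
  | insert i J hi ih =>
    by_contra! hlarge
    rw [card_insert_of_notMem hi] at hcard hlarge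
    rcases J.eq_empty_or_nonempty with rfl | hJ'
    · simp only [card_empty, zero_add, Nat.add_right_cancel_iff] at hcard
      subst hcard
      have h1 := hlarge i (mem_insert_self _ _)
      have h2 : (#(cnb G (M i) B) : ℝ) ≤ #(cnb G S B) := by
        exact_mod_cast card_le_card (cnb_mono (hMS i) B)
      have h3 := hbook B hBS hB
      simp only [card_empty, zero_add, Nat.cast_one, one_mul] at h1
      linarith
    · have h1 := hlarge i (mem_insert_self _ _)
      have hpos : 0 < #(cnb G (M i) B) := by
        have : (0 : ℝ) < #(cnb G (M i) B) := lt_of_lt_of_le (by positivity) h1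
        exact_mod_cast this
      obtain ⟨w, hw⟩ := card_pos.1 hpos
      have hwM := (mem_cnb.1 hw).1
      obtain ⟨j, hj, hlt⟩ := ih hJ' (insert_subset (hMS i hwM) hBS)
        (isNClique_insert_of_mem_cnb hB hw) (by omega)
      have h2 := hlarge j (mem_insert_of_mem hj)
      have h3 := hM i j (by rintro rfl; exact hi hj) w hwM
      have h4 := card_cnb_insert_ge (G := G) (M j) B w
      push_cast at h2
      linarith

theorem card_sdiff_nb_le_of_few {S M N : Finset V} {b θ μ τ : ℝ} {u : V}
    (hb : (#(S \ nb G S u) : ℝ) ≤ b) (hMS : M ⊆ S) (hNS : N ⊆ S)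
    (hM : μ ≤ #M) (hfew : (#(nb G M u) : ℝ) ≤ θ) (hMN : (#(M ∩ N) : ℝ) ≤ τ) :
    (#(N \ nb G N u) : ℝ) ≤ b - μ + θ + τ := by
  have hsub : (N \ nb G N u) ∪ (M \ nb G M u) ⊆ S \ nb G S u := by
    intro w
    simp only [mem_union, mem_sdiff, mem_nb]
    rintro (h | h)
    · exact ⟨hNS h.1, fun h' => h.2 ⟨h.1, h'.2⟩⟩
    · exact ⟨hMS h.1, fun h' => h.2 ⟨h.1, h'.2⟩⟩
  have hint : (N \ nb G N u) ∩ (M \ nb G M u) ⊆ M ∩ N := by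
    intro w
    simp only [mem_inter, mem_sdiff]
    tauto
  have h1 := card_union_add_card_inter (N \ nb G N u) (M \ nb G M u)
  have h2 := card_le_card hsub
  have h3 := card_le_card hint
  have h4 : (#(M \ nb G M u) : ℝ) = #M - #(nb G M u) := cast_card_sdiff (nb_subset M u)
  have h5 : (#(N \ nb G N u) : ℝ) + #(M \ nb G M u) ≤ #(S \ nb G S u) + #(M ∩ N) := by
    exact_mod_cast (by omega :
      #(N \ nb G N u) + #(M \ nb G M u) ≤ #(S \ nb G S u) + #(M ∩ N))
  linarith

/-- If the minimum degree of `G` on `S` is almost `(1 - 1 / k) * #S` and all `k`-cliques have few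
common neighbours, then `S` spans a `k`-partite graph. -/
theorem exists_coloring_of_minDegree {S : Finset V} (hS : S.Nonempty) {k : ℕ} (hk : 2 ≤ k)
    {e τ : ℝ} (he : 0 ≤ e) (hτ : 0 < τ)
    (hsmall : k * ((3 * k + 2) * e + (6 * k + 3) * τ) ≤ #S)
    (hdeg : ∀ u ∈ S, k * (#(S \ nb G S u) : ℝ) ≤ #S + e)
    (hbook : ∀ B ⊆ S, G.IsNClique k B → (#(cnb G S B) : ℝ) < τ) :
    ∃ col : V → Fin k, ∀ u ∈ S, ∀ v ∈ S, G.Adj u v → col u ≠ col v := by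
  have hk0 : (0 : ℝ) < k := by positivity
  have hk2 : (2 : ℝ) ≤ k := by exact_mod_cast hk
  have hm0 : (0 : ℝ) < #S := by exact_mod_cast hS.card_pos
  obtain ⟨b, hbk⟩ : ∃ b : ℝ, k * b = #S + e := ⟨(#S + e) / k, by field_simp⟩
  have hb : ∀ u ∈ S, (#(S \ nb G S u) : ℝ) ≤ b := fun u hu =>
    le_of_mul_le_mul_left ((hdeg u hu).trans_eq hbk.symm) hk0
  have hbe : (3 * k + 2) * e + (6 * k + 3) * τ ≤ b :=
    le_of_mul_le_mul_left (by linarith) hk0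
  have hkτ : 0 ≤ (6 * k + 3) * τ := by positivity
  have hke : 0 ≤ (k : ℝ) * e := by positivity
  have heb : e < b := by nlinarith
  have hb0 : 0 ≤ b := he.trans heb.le
  obtain ⟨K, hKS, hK⟩ := exists_isNClique hb hb0 (k := k) (by linarith)
  let v : Fin k ≃ K := (Fintype.equivFinOfCardEq (by simpa using hK.card_eq)).symm
  let M : Fin k → Finset V := fun i => cnb G S (K.erase (v i))
  have hMS : ∀ i, M i ⊆ S := fun i => filter_subset _ _
  have hMcard : ∀ i, b - e ≤ #(M i) := fun i => by
    have h := card_cnb_ge hb ((erase_subset (v i : V) K).trans hKS)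
    rw [card_erase_of_mem (v i).2, hK.card_eq, Nat.cast_sub (by omega)] at h
    push_cast at h
    simp only [M]
    linarith
  have hMM : ∀ i j, i ≠ j → (#(M i ∩ M j) : ℝ) ≤ τ := fun i j hij => by
    refine le_trans ?_ (hbook K hKS hK).le
    norm_cast
    refine card_le_card fun w hw => ?_
    rw [mem_inter, mem_cnb, mem_cnb] at hw
    refine mem_cnb.2 ⟨hw.1.1, fun z hz => ?_⟩
    by_cases hzi : z = v i
    · refine hw.2.2 z (mem_erase.2 ⟨?_, hz⟩)
      rw [hzi]
      exact fun h => hij (v.injective (Subtype.ext h))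
    · exact hw.1.2 z (mem_erase.2 ⟨hzi, hz⟩)
  have hMin : ∀ i, ∀ u ∈ M i, (#(nb G (M i) u) : ℝ) ≤ τ := fun i u hu => by
    have hcl : G.IsNClique k (insert u (K.erase (v i))) := by
      have := isNClique_insert_of_mem_cnb (hK.erase_of_mem (v i).2) hu
      rwa [Nat.sub_add_cancel (by omega)] at this
    refine le_trans ?_ (hbook _ (insert_subset (hMS i hu) ((erase_subset _ _).trans hKS)) hcl).le
    norm_cast
    refine card_le_card fun w hw => ?_
    obtain ⟨hw1, hw2⟩ := mem_nb.1 hw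
    refine mem_cnb.2 ⟨hMS i hw1, fun z hz => ?_⟩
    rcases mem_insert.1 hz with rfl | hz
    · exact hw2
    · exact (mem_cnb.1 hw1).2 z hz
  have hMout : ∀ i j, i ≠ j → ∀ θ : ℝ, ∀ u ∈ S, (#(nb G (M i) u) : ℝ) ≤ θ →
      (#(M j \ nb G (M j) u) : ℝ) ≤ e + θ + τ := fun i j hij θ u hu hθ => by
    have := card_sdiff_nb_le_of_few (hb u hu) (hMS i) (hMS j) (hMcard i) hθ (hMM i j hij)
    linarith
  have hMρ : ∀ i j, i ≠ j → ∀ w ∈ M i, (#(M j \ nb G (M j) w) : ℝ) ≤ e + 2 * τ :=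
    fun i j hij w hw => by
      have := hMout i j hij τ w (hMS i hw) (hMin i w hw)
      linarith
  have hρ : 0 ≤ e + 2 * τ := by positivity
  have hcol : ∀ u, ∃ i, u ∈ S → (#(nb G (M i) u) : ℝ) ≤ k * (e + 2 * τ) + τ := by
    intro u
    by_cases hu : u ∈ S
    · have : NeZero k := ⟨by omega⟩
      obtain ⟨i, -, hi⟩ := exists_few_common_neighbors hτ hρ hbook hMS hMρ
        (J := univ) univ_nonempty (B := {u}) (by simpa using hu) (b := 1)
        (SimpleGraph.isNClique_singleton.2 rfl) (by simp [add_comm])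
      refine ⟨i, fun _ => ?_⟩
      have heq : cnb G (M i) {u} = nb G (M i) u := by ext; simp
      rw [heq] at hi
      simpa using hi.le
    · exact ⟨⟨0, by omega⟩, fun h => absurd h hu⟩
  choose col hcol using hcol
  refine ⟨col, fun u hu w hw hadj hc => ?_⟩
  have hJ : (univ.erase (col u)).Nonempty := by
    rw [← card_pos, card_erase_of_mem (mem_univ _), card_univ, Fintype.card_fin]
    omega
  have hcJ : #(univ.erase (col u)) = k - 1 := by
    rw [card_erase_of_mem (mem_univ _), card_univ, Fintype.card_fin]
  obtain ⟨j, hj, hlt⟩ := exists_few_common_neighbors hτ hρ hbook hMS hMρ hJ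
    (B := {u, w}) (insert_subset hu (by simpa using hw)) (b := 2)
    ((SimpleGraph.isNClique_singleton.2 rfl : G.IsNClique 1 {w}).insert (by simpa using hadj))
    (by omega)
  have hij : col u ≠ j := (ne_of_mem_erase hj).symm
  have h1 := hMout _ j hij _ u hu (hcol u hu)
  have h2 := hMout _ j hij (k * (e + 2 * τ) + τ) w hw (by rw [hc]; exact hcol w hw)
  have h3 := card_cnb_insert_ge (G := G) (M j) {w} u
  have h4 := card_cnb_insert_ge (G := G) (M j) ∅ w
  rw [cnb_empty] at h4
  have h5 := hMcard j
  rw [hcJ, Nat.cast_sub (by omega), Nat.cast_one] at hlt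
  have h6 : insert w (∅ : Finset V) = {w} := rfl
  rw [h6] at h4
  linarith

end Structure

section Multipartite

variable {V : Type*} {k : ℕ}

/-- The vertices of `S` of colour `i`. -/
def colorClass (S : Finset V) (col : V → Fin k) (i : Fin k) : Finset V := S.filter (col · = i)

@[simp] theorem mem_colorClass {S : Finset V} {col : V → Fin k} {i : Fin k} {v : V} :
    v ∈ colorClass S col i ↔ v ∈ S ∧ col v = i := by
  simp [colorClass]

theorem colorClass_subset (S : Finset V) (col : V → Fin k) (i : Fin k) :
    colorClass S col i ⊆ S := filter_subset _ _

theorem sum_colorClass (S : Finset V) (col : V → Fin k) (f : V → ℝ) :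
    ∑ i, ∑ v ∈ colorClass S col i, f v = ∑ v ∈ S, f v :=
  sum_fiberwise S col f

theorem sum_card_colorClass (S : Finset V) (col : V → Fin k) :
    ∑ i, #(colorClass S col i) = #S :=
  (card_eq_sum_card_fiberwise fun _ _ => mem_coe.2 (mem_univ _)).symm

theorem sum_eigenvector_pos {S : Finset V} {x : V → ℝ} (hx0 : ∀ v, 0 ≤ x v)
    (hx : ∑ v ∈ S, x v ^ 2 = 1) : 0 < ∑ v ∈ S, x v := by
  refine (sum_nonneg fun v _ => hx0 v).lt_of_ne fun h => ?_
  have h0 := (sum_eq_zero_iff_of_nonneg fun v _ => hx0 v).1 h.symm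
  rw [sum_eq_zero fun v hv => by rw [h0 v hv]; norm_num] at hx
  exact one_ne_zero hx.symm

variable [DecidableEq V] {G : SimpleGraph V} [DecidableRel G.Adj]

theorem nb_subset_sdiff_colorClass {S : Finset V} {col : V → Fin k}
    (hcol : ∀ u ∈ S, ∀ v ∈ S, G.Adj u v → col u ≠ col v) {v : V} (hv : v ∈ S) :
    nb G S v ⊆ S \ colorClass S col (col v) := by
  intro w hw
  rw [mem_nb] at hw
  simp only [mem_sdiff, mem_colorClass, not_and]
  exact ⟨hw.1, fun _ h => hcol v hv w hw.1 hw.2 h.symm⟩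

/-- The inequality satisfied by an eigenvector on a `k`-partite graph, vertex by vertex. -/
theorem eigenvector_le_of_coloring {S : Finset V} {col : V → Fin k}
    (hcol : ∀ u ∈ S, ∀ v ∈ S, G.Adj u v → col u ≠ col v) {q : ℝ} {x : V → ℝ}
    (hx0 : ∀ v, 0 ≤ x v) (he : ∀ v ∈ S, (q - #(nb G S v)) * x v = ∑ w ∈ nb G S v, x w)
    {v : V} (hv : v ∈ S) :
    (q - #S + #(colorClass S col (col v))) * x v
      ≤ ∑ w ∈ S, x w - ∑ w ∈ colorClass S col (col v), x w := by
  have hsub := nb_subset_sdiff_colorClass hcol hv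
  have h1 : (#(nb G S v) : ℝ) ≤ #S - #(colorClass S col (col v)) := by
    rw [← cast_card_sdiff (colorClass_subset _ _ _)]
    exact_mod_cast card_le_card hsub
  have h2 : ∑ w ∈ nb G S v, x w ≤ ∑ w ∈ S \ colorClass S col (col v), x w :=
    sum_le_sum_of_subset_of_nonneg hsub fun w _ _ => hx0 w
  rw [sum_sdiff_eq_sub (colorClass_subset _ _ _), ← he v hv] at h2
  exact le_trans (mul_le_mul_of_nonneg_right (by linarith) (hx0 v)) h2

theorem sum_colorClass_le {S : Finset V} {col : V → Fin k}
    (hcol : ∀ u ∈ S, ∀ v ∈ S, G.Adj u v → col u ≠ col v) {q : ℝ} {x : V → ℝ}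
    (hx0 : ∀ v, 0 ≤ x v) (he : ∀ v ∈ S, (q - #(nb G S v)) * x v = ∑ w ∈ nb G S v, x w)
    (i : Fin k) :
    (q - #S + 2 * #(colorClass S col i)) * ∑ v ∈ colorClass S col i, x v
      ≤ #(colorClass S col i) * ∑ v ∈ S, x v := by
  have h : ∑ v ∈ colorClass S col i, (q - #S + #(colorClass S col i)) * x v
      ≤ ∑ v ∈ colorClass S col i, (∑ w ∈ S, x w - ∑ w ∈ colorClass S col i, x w) := by
    refine sum_le_sum fun v hv => ?_
    obtain ⟨hvS, rfl⟩ := mem_colorClass.1 hv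
    exact eigenvector_le_of_coloring hcol hx0 he hvS
  rw [← mul_sum, sum_const, nsmul_eq_mul] at h
  linarith

variable [Fintype V] [Nonempty V]

theorem one_le_sum_of_coloring {S : Finset V} {col : V → Fin k}
    (hcol : ∀ u ∈ S, ∀ v ∈ S, G.Adj u v → col u ≠ col v) (hq : #S < rad G S) :
    1 ≤ ∑ i, (#(colorClass S col i) : ℝ) / (rad G S - #S + 2 * #(colorClass S col i)) := by
  obtain ⟨x, hx0, hx, he⟩ := exists_rad_eigenvector (lt_of_le_of_lt (by positivity) hq)
  have hX := sum_eigenvector_pos hx0 hx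
  have hp : 0 < rad G S - #S := sub_pos.2 hq
  refine le_of_mul_le_mul_right ?_ hX
  rw [one_mul, sum_mul]
  nth_rw 1 [← sum_colorClass S col]
  refine sum_le_sum fun i _ => ?_
  have hd : 0 < rad G S - #S + 2 * (#(colorClass S col i) : ℝ) := by positivity
  rw [div_mul_eq_mul_div, le_div_iff₀ hd, mul_comm]
  exact sum_colorClass_le hcol hx0 he i

theorem sum_eq_one_of_complete {S : Finset V} {col : V → Fin k}
    (hcol : ∀ u ∈ S, ∀ v ∈ S, G.Adj u v ↔ col u ≠ col v) (hq : #S < rad G S) :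
    ∑ i, (#(colorClass S col i) : ℝ) / (rad G S - #S + 2 * #(colorClass S col i)) = 1 := by
  obtain ⟨x, hx0, hx, he⟩ := exists_rad_eigenvector (lt_of_le_of_lt (by positivity) hq)
  have hX := sum_eigenvector_pos hx0 hx
  have hp : 0 < rad G S - #S := sub_pos.2 hq
  refine mul_right_cancel₀ hX.ne' ?_
  rw [one_mul, sum_mul]
  nth_rw 2 [← sum_colorClass S col]
  refine sum_congr rfl fun i _ => ?_
  have hd : 0 < rad G S - #S + 2 * (#(colorClass S col i) : ℝ) := by positivity
  rw [div_mul_eq_mul_div, div_eq_iff hd.ne']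
  have h : ∑ v ∈ colorClass S col i, (rad G S - #S + #(colorClass S col i)) * x v
      = ∑ v ∈ colorClass S col i, (∑ w ∈ S, x w - ∑ w ∈ colorClass S col i, x w) := by
    refine sum_congr rfl fun v hv => ?_
    obtain ⟨hvS, rfl⟩ := mem_colorClass.1 hv
    have hnb : nb G S v = S \ colorClass S col (col v) := by
      ext w
      simp only [mem_nb, mem_sdiff, mem_colorClass, not_and]
      exact and_congr_right fun hw => by rw [hcol v hvS w hw]; tauto
    have := he v hvS
    rw [hnb, cast_card_sdiff (colorClass_subset _ _ _),
      sum_sdiff_eq_sub (colorClass_subset _ _ _)] at this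
    linarith
  rw [← mul_sum, sum_const, nsmul_eq_mul] at h
  linarith

theorem adj_of_sum_le_one {S : Finset V} {col : V → Fin k}
    (hcol : ∀ u ∈ S, ∀ v ∈ S, G.Adj u v → col u ≠ col v) (hq : #S < rad G S)
    (hsum : ∑ i, (#(colorClass S col i) : ℝ) / (rad G S - #S + 2 * #(colorClass S col i)) ≤ 1)
    {u v : V} (hu : u ∈ S) (hv : v ∈ S) (huv : col u ≠ col v) : G.Adj u v := by
  obtain ⟨x, hx0, hx, he⟩ := exists_rad_eigenvector (lt_of_le_of_lt (by positivity) hq)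
  have hX := sum_eigenvector_pos hx0 hx
  have hp : 0 < rad G S - #S := sub_pos.2 hq
  have hd : ∀ i, 0 < rad G S - #S + 2 * (#(colorClass S col i) : ℝ) := fun i => by positivity
  have hle : ∀ i ∈ univ, ∑ v ∈ colorClass S col i, x v
      ≤ (#(colorClass S col i) : ℝ) / (rad G S - #S + 2 * #(colorClass S col i))
        * ∑ v ∈ S, x v := by
    intro i _
    rw [div_mul_eq_mul_div, le_div_iff₀ (hd i), mul_comm]
    exact sum_colorClass_le hcol hx0 he i
  have heq := (sum_eq_sum_iff_of_le hle).1 (le_antisymm (sum_le_sum hle) (by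
    rw [← sum_mul, sum_colorClass]
    exact (mul_le_mul_of_nonneg_right hsum hX.le).trans_eq (one_mul _))) (col u) (mem_univ _)
  rw [div_mul_eq_mul_div, eq_div_iff (hd _).ne'] at heq
  have hle2 : ∀ w ∈ colorClass S col (col u), (rad G S - #S + #(colorClass S col (col u))) * x w
      ≤ ∑ w ∈ S, x w - ∑ w ∈ colorClass S col (col u), x w := by
    intro w hw
    obtain ⟨hwS, hwu⟩ := mem_colorClass.1 hw
    rw [← hwu]
    exact eigenvector_le_of_coloring hcol hx0 he hwS
  have heq2 := (sum_eq_sum_iff_of_le hle2).1 (by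
    rw [← mul_sum, sum_const, nsmul_eq_mul]
    linarith) u (mem_colorClass.2 ⟨hu, rfl⟩)
  have hn : (0 : ℝ) ≤ #(colorClass S col (col u)) := by positivity
  have hlt : ∑ w ∈ colorClass S col (col u), x w < ∑ w ∈ S, x w := by
    have h0 : 0 ≤ ∑ w ∈ colorClass S col (col u), x w := sum_nonneg fun w _ => hx0 w
    by_contra! hge
    nlinarith [mul_le_mul_of_nonneg_left hge hn]
  have hxu : 0 < x u := by
    by_contra! h
    have : x u = 0 := le_antisymm h (hx0 u)
    rw [this, mul_zero] at heq2
    linarith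
  have hsub := nb_subset_sdiff_colorClass hcol hu
  have h2 : ∑ w ∈ nb G S u, x w ≤ ∑ w ∈ S \ colorClass S col (col u), x w :=
    sum_le_sum_of_subset_of_nonneg hsub fun w _ _ => hx0 w
  rw [sum_sdiff_eq_sub (colorClass_subset _ _ _), ← he u hu, ← heq2] at h2
  have h3 := le_of_mul_le_mul_right h2 hxu
  have h4 : (#(S \ colorClass S col (col u)) : ℝ) ≤ #(nb G S u) := by
    rw [cast_card_sdiff (colorClass_subset _ _ _)]
    linarith
  have h5 := eq_of_subset_of_card_le hsub (by exact_mod_cast h4)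
  have hvm : v ∈ nb G S u := by
    rw [h5]
    simp only [mem_sdiff, mem_colorClass, not_and]
    exact ⟨hv, fun _ h => huv h.symm⟩
  exact (mem_nb.1 hvm).2

theorem rad_le_of_coloring (hk : 2 ≤ k) {S : Finset V} {col : V → Fin k}
    (hcol : ∀ u ∈ S, ∀ v ∈ S, G.Adj u v → col u ≠ col v) :
    rad G S ≤ 2 * (1 - 1 / k) * #S := by
  have hk2 : (2 : ℝ) ≤ k := by exact_mod_cast hk
  have hk0 : (0 : ℝ) < k := by linarith
  have hm0 : (0 : ℝ) ≤ #S := by positivity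
  rcases le_or_gt (rad G S) #S with h | h
  · have : (1 : ℝ) / k ≤ 1 / 2 := by gcongr
    nlinarith
  have h1 := one_le_sum_of_coloring hcol h
  have hp : 0 < rad G S - #S := sub_pos.2 h
  set p := rad G S - #S with hpdef
  set s : ℝ := #S / k with hs
  have hks : k * s = #S := by rw [hs]; field_simp
  have hs0 : 0 ≤ s := by positivity
  have htan : ∀ i ∈ univ, (#(colorClass S col i) : ℝ) / (p + 2 * #(colorClass S col i))
      ≤ s / (p + 2 * s) + p / (p + 2 * s) ^ 2 * (#(colorClass S col i) - s) := by
    intro i _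
    have ht : (0 : ℝ) ≤ #(colorClass S col i) := by positivity
    generalize (#(colorClass S col i) : ℝ) = t at ht ⊢
    have h1 : 0 < p + 2 * t := by positivity
    have h2 : 0 < p + 2 * s := by positivity
    have h3 : s / (p + 2 * s) + p / (p + 2 * s) ^ 2 * (t - s) - t / (p + 2 * t)
        = 2 * p * (t - s) ^ 2 / ((p + 2 * t) * (p + 2 * s) ^ 2) := by
      field_simp
      ring
    have h4 : 0 ≤ 2 * p * (t - s) ^ 2 / ((p + 2 * t) * (p + 2 * s) ^ 2) := by positivity
    linarith
  have h2 := h1.trans (sum_le_sum htan)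
  rw [sum_add_distrib, ← mul_sum, sum_sub_distrib, sum_const, sum_const, card_univ,
    Fintype.card_fin, nsmul_eq_mul, nsmul_eq_mul, ← Nat.cast_sum, sum_card_colorClass, hks,
    sub_self, mul_zero, add_zero, ← mul_div_assoc, hks, le_div_iff₀ (by positivity)] at h2
  have : 2 * (1 - 1 / (k : ℝ)) * #S = 2 * #S - 2 * s := by rw [hs]; ring
  linarith

end Multipartite

section Turan

/-- The colouring of the Turán graph by residues modulo `k`. -/
def turanColoring (n : ℕ) {k : ℕ} (hk : 0 < k) (v : Fin n) : Fin k := ⟨v % k, Nat.mod_lt _ hk⟩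

theorem turanGraph_adj_iff {n k : ℕ} (hk : 0 < k) (u v : Fin n) :
    (SimpleGraph.turanGraph n k).Adj u v ↔ turanColoring n hk u ≠ turanColoring n hk v := by
  simp [SimpleGraph.turanGraph, turanColoring, Fin.ext_iff]

theorem card_colorClass_turanColoring {n k : ℕ} (hk : 0 < k) (i : Fin k) :
    #(colorClass univ (turanColoring n hk) i) = n / k ∨
      #(colorClass univ (turanColoring n hk) i) = n / k + 1 := by
  have h : #(colorClass univ (turanColoring n hk) i) = n.count (· ≡ i [MOD k]) := by
    rw [Nat.count_eq_card_filter_range, ← card_map Fin.valEmbedding]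
    congr 1
    ext w
    simp only [mem_map, mem_colorClass, mem_univ, true_and, mem_filter, mem_range, turanColoring,
      Fin.ext_iff, Fin.valEmbedding_apply, Nat.ModEq, Nat.mod_eq_of_lt i.2]
    constructor
    · rintro ⟨v, hv, rfl⟩
      exact ⟨v.2, hv⟩
    · rintro ⟨hw, hwi⟩
      exact ⟨⟨w, hw⟩, hwi, rfl⟩
  rw [h, Nat.count_modEq_card _ hk]
  split_ifs <;> simp

theorem balanced_iff {t a : ℕ} : ((t : ℝ) - a) * (t - a - 1) = 0 ↔ t = a ∨ t = a + 1 := by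
  rw [mul_eq_zero, sub_eq_zero, sub_sub, sub_eq_zero]
  norm_cast

theorem balanced_nonneg (t a : ℕ) : 0 ≤ ((t : ℝ) - a) * (t - a - 1) := by
  rcases le_or_gt t a with h | h
  · have : (t : ℝ) ≤ a := by exact_mod_cast h
    nlinarith
  · have : (a : ℝ) + 1 ≤ t := by exact_mod_cast h
    nlinarith

/-- Interpolation of the concave function `t ↦ t / (p + 2 * t)` between `a` and `a + 1`. -/
theorem div_add_two_mul_eq {p : ℝ} (hp : 0 < p) {t a : ℝ} (ht : 0 ≤ t) (ha : 0 ≤ a) :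
    t / (p + 2 * t) = a / (p + 2 * a) +
      ((a + 1) / (p + 2 * (a + 1)) - a / (p + 2 * a)) * (t - a) -
      2 * p / ((p + 2 * t) * (p + 2 * a) * (p + 2 * (a + 1))) * ((t - a) * (t - a - 1)) := by
  have h1 : 0 < p + 2 * t := by positivity
  have h2 : 0 < p + 2 * a := by positivity
  have h3 : 0 < p + 2 * (a + 1) := by positivity
  field_simp
  ring

/-- Among sequences of natural numbers with given sum, the balanced ones are the only maximizers of
`∑ i, t i / (p + 2 * t i)`. -/
theorem sum_div_le_of_balanced {ι : Type*} [Fintype ι] {p : ℝ} (hp : 0 < p) {a : ℕ} {s t : ι → ℕ}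
    (hst : ∑ i, s i = ∑ i, t i) (ht : ∀ i, t i = a ∨ t i = a + 1) :
    ∑ i, (s i : ℝ) / (p + 2 * s i) ≤ ∑ i, (t i : ℝ) / (p + 2 * t i) ∧
      (∑ i, (t i : ℝ) / (p + 2 * t i) ≤ ∑ i, (s i : ℝ) / (p + 2 * s i) →
        ∀ i, s i = a ∨ s i = a + 1) := by
  have hst' : ∑ i, (s i : ℝ) = ∑ i, (t i : ℝ) := by exact_mod_cast hst
  have hsum : ∀ r : ι → ℕ, ∑ i, (r i : ℝ) / (p + 2 * r i) =
      ∑ _i : ι, (a : ℝ) / (p + 2 * a) +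
      ((a + 1 : ℝ) / (p + 2 * (a + 1)) - a / (p + 2 * a)) * (∑ i, (r i : ℝ) - ∑ _i : ι, (a : ℝ)) -
      ∑ i, 2 * p / ((p + 2 * r i) * (p + 2 * a) * (p + 2 * (a + 1))) *
        (((r i : ℝ) - a) * (r i - a - 1)) := by
    intro r
    rw [← sum_sub_distrib, mul_sum, ← sum_add_distrib, ← sum_sub_distrib]
    exact sum_congr rfl fun i _ => div_add_two_mul_eq hp (by positivity) (by positivity)
  have ht0 : ∑ i, 2 * p / ((p + 2 * t i) * (p + 2 * a) * (p + 2 * (a + 1))) *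
      (((t i : ℝ) - a) * (t i - a - 1)) = 0 :=
    sum_eq_zero fun i _ => by rw [balanced_iff.2 (ht i), mul_zero]
  have hnn : ∀ i ∈ univ, 0 ≤ 2 * p / ((p + 2 * s i) * (p + 2 * a) * (p + 2 * (a + 1))) *
      (((s i : ℝ) - a) * (s i - a - 1)) := fun i _ =>
    mul_nonneg (by positivity) (balanced_nonneg _ _)
  rw [hsum s, hsum t, hst', ht0]
  refine ⟨by linarith [sum_nonneg hnn], fun h i => ?_⟩
  have h0 := (sum_eq_zero_iff_of_nonneg hnn).1 (le_antisymm (by linarith) (sum_nonneg hnn)) i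
    (mem_univ i)
  refine balanced_iff.1 ((mul_eq_zero.1 h0).resolve_left ?_)
  positivity

variable {V : Type*} {G : SimpleGraph V} [DecidableRel G.Adj] {k : ℕ}

theorem generalizedBook_isContained {B : Finset V} (hB : G.IsNClique k B) (S : Finset V) :
    SimpleGraph.IsContained (generalizedBook k #(cnb G S B)) G := by
  let v : Fin k ≃ B := (Fintype.equivFinOfCardEq (by simpa using hB.card_eq)).symm
  let w : Fin #(cnb G S B) ≃ cnb G S B := (cnb G S B).equivFin.symm
  have hvw : ∀ i j, G.Adj (v i : V) (w j) := fun i j => (mem_cnb.1 (w j).2).2 _ (v i).2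
  refine ⟨⟨⟨Sum.elim (fun i => (v i : V)) (fun j => (w j : V)), ?_⟩, ?_⟩⟩
  · rintro (i | i) (j | j) h
    · have hij : i ≠ j := by simpa [generalizedBook] using h
      exact hB.isClique (v i).2 (v j).2 fun h => hij (v.injective (Subtype.ext h))
    · exact hvw i j
    · exact (hvw j i).symm
    · simp [generalizedBook] at h
  · rintro (i | i) (j | j) h
    · exact congrArg _ (v.injective (Subtype.ext h))
    · exact absurd h (hvw i j).ne
    · exact absurd h (hvw j i).ne'
    · exact congrArg _ (w.injective (Subtype.ext h))

variable [Fintype V]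

theorem two_mul_card_edgeFinset :
    2 * (#G.edgeFinset : ℝ) = ∑ v, (#(nb G univ v) : ℝ) := by
  have h := G.sum_degrees_eq_twice_card_edges
  have h2 : ∀ v, #(nb G univ v) = G.degree v := fun v => by
    rw [← SimpleGraph.card_neighborFinset_eq_degree]
    congr 1
    ext; simp
  simp only [h2]
  exact_mod_cast h.symm

variable [DecidableEq V]

theorem sum_card_nb_of_complete {col : V → Fin k} (hcol : ∀ u v, G.Adj u v ↔ col u ≠ col v) :
    ∑ v, (#(nb G univ v) : ℝ)
      = (Fintype.card V : ℝ) ^ 2 - ∑ i, (#(colorClass univ col i) : ℝ) ^ 2 := by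
  have h : ∀ v : V, (#(nb G univ v) : ℝ) = Fintype.card V - #(colorClass univ col (col v)) := by
    intro v
    have hnb : nb G univ v = univ \ colorClass univ col (col v) := by
      ext w
      simp only [mem_nb, mem_sdiff, mem_colorClass, mem_univ, true_and, hcol]
      tauto
    rw [hnb, cast_card_sdiff (subset_univ _), card_univ]
  rw [sum_congr rfl fun v _ => h v, sum_sub_distrib, sum_const, card_univ, nsmul_eq_mul,
    ← sum_colorClass univ col, sq]
  congr 1
  refine sum_congr rfl fun i _ => ?_
  rw [sum_congr rfl fun v hv => by rw [(mem_colorClass.1 hv).2], sum_const, nsmul_eq_mul, sq]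

theorem sum_sq_eq_of_balanced {ι : Type*} [Fintype ι] {a : ℕ} {t : ι → ℕ}
    (ht : ∀ i, t i = a ∨ t i = a + 1) :
    ∑ i, (t i : ℝ) ^ 2 = (2 * a + 1) * ∑ i, (t i : ℝ) - ∑ _i : ι, (a * (a + 1) : ℝ) := by
  rw [mul_sum, ← sum_sub_distrib]
  refine sum_congr rfl fun i _ => ?_
  have := balanced_iff.2 (ht i)
  linarith

theorem two_mul_sum_card_nb_le [Nonempty V] :
    2 * ∑ v, (#(nb G univ v) : ℝ) ≤ rad G univ * Fintype.card V := by
  have h := rayleigh_rad_le (G := G) univ (fun _ => 1)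
  simpa [mul_sum, two_mul, sum_add_distrib] using h

theorem le_rad_turanGraph {n : ℕ} (hn : 0 < n) (hk : 0 < k) :
    2 * (1 - 1 / k) * n - 2 * k / n ≤ rad (SimpleGraph.turanGraph n k) univ := by
  have : Nonempty (Fin n) := ⟨⟨0, hn⟩⟩
  have hn0 : (0 : ℝ) < n := by exact_mod_cast hn
  have hk0 : (0 : ℝ) < k := by exact_mod_cast hk
  have h := two_mul_sum_card_nb_le (G := SimpleGraph.turanGraph n k)
  rw [sum_card_nb_of_complete (turanGraph_adj_iff hk), Fintype.card_fin] at h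
  have hsum : ∑ i, (#(colorClass univ (turanColoring n hk) i) : ℝ) = n := by
    rw [← Nat.cast_sum, sum_card_colorClass, card_univ, Fintype.card_fin]
  have hs1 : ((n / k : ℕ) : ℝ) ≤ n / k := Nat.cast_div_le
  have hs2 : (n : ℝ) / k ≤ (n / k : ℕ) + 1 := by
    rw [div_le_iff₀ hk0]
    exact_mod_cast (by
      have := Nat.lt_div_mul_add hk (a := n)
      linarith : n ≤ (n / k + 1) * k)
  have hsq : ∑ i, (#(colorClass univ (turanColoring n hk) i) : ℝ) ^ 2 ≤ n ^ 2 / k + k := by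
    have h1 : ∀ i ∈ univ, (#(colorClass univ (turanColoring n hk) i) : ℝ) ^ 2
        ≤ 2 * (n / k) * #(colorClass univ (turanColoring n hk) i) + (1 - (n / k : ℝ) ^ 2) := by
      intro i _
      have h2 : |(#(colorClass univ (turanColoring n hk) i) : ℝ) - n / k| ≤ 1 := by
        rw [abs_le]
        rcases card_colorClass_turanColoring (n := n) hk i with h | h <;> rw [h] <;>
          push_cast <;> constructor <;> linarith
      have := (sq_le_one_iff_abs_le_one _).2 h2
      linarith
    refine (sum_le_sum h1).trans (le_of_eq ?_)
    rw [sum_add_distrib, ← mul_sum, hsum, sum_const, card_univ, Fintype.card_fin, nsmul_eq_mul]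
    field_simp
    ring
  refine le_of_mul_le_mul_right ?_ hn0
  have e1 : (2 * (1 - 1 / (k : ℝ)) * n - 2 * k / n) * n = 2 * (n ^ 2 - (n ^ 2 / k + k)) := by
    field_simp
    ring
  rw [e1]
  linarith

/-- Among `k`-partite graphs on `n` vertices the Turán graph is the unique maximizer of the
signless Laplacian radius. -/
theorem nonempty_iso_turanGraph_of_coloring {n : ℕ} (hk : 0 < k)
    {G : SimpleGraph (Fin n)} [DecidableRel G.Adj] {col : Fin n → Fin k}
    (hcol : ∀ u v, G.Adj u v → col u ≠ col v)
    (hT : n < rad (SimpleGraph.turanGraph n k) univ)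
    (hq : rad (SimpleGraph.turanGraph n k) univ ≤ rad G univ) :
    Nonempty (G ≃g SimpleGraph.turanGraph n k) := by
  rcases Nat.eq_zero_or_pos n with rfl | hn
  · exact ⟨⟨Equiv.refl _, fun {u} => u.elim0⟩⟩
  have : Nonempty (Fin n) := ⟨⟨0, hn⟩⟩
  have hcard : (#(univ : Finset (Fin n)) : ℝ) = n := by simp
  have hp0 : 0 < rad (SimpleGraph.turanGraph n k) univ - n := sub_pos.2 hT
  have hp : 0 < rad G univ - n := by linarith
  have hG := hT.trans_le hq
  have hTsum := sum_eq_one_of_complete (G := SimpleGraph.turanGraph n k) (S := univ)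
    (col := turanColoring n hk) (fun u _ v _ => turanGraph_adj_iff hk u v) (by rwa [hcard])
  have hGsum := one_le_sum_of_coloring (G := G) (S := univ) (col := col)
    (fun u _ v _ => hcol u v) (by rwa [hcard])
  rw [hcard] at hTsum hGsum
  have hbal := card_colorClass_turanColoring (n := n) hk
  have hcsum : ∑ i, #(colorClass univ col i)
      = ∑ i, #(colorClass univ (turanColoring n hk) i) := by
    rw [sum_card_colorClass, sum_card_colorClass]
  obtain ⟨h1, h2⟩ := sum_div_le_of_balanced hp hcsum hbal
  have h3 : ∑ i, (#(colorClass univ (turanColoring n hk) i) : ℝ) /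
      (rad G univ - n + 2 * #(colorClass univ (turanColoring n hk) i)) ≤ 1 := by
    rw [← hTsum]
    gcongr
  have hGbal := h2 (h3.trans hGsum)
  have hadj : ∀ u v, G.Adj u v ↔ col u ≠ col v := fun u v =>
    ⟨hcol u v, adj_of_sum_le_one (S := univ) (fun u _ v _ => hcol u v) (by rwa [hcard])
      (by rw [hcard]; exact h1.trans h3) (mem_univ u) (mem_univ v)⟩
  have hedge : #G.edgeFinset = #(SimpleGraph.turanGraph n k).edgeFinset := by
    have e1 := two_mul_card_edgeFinset (G := G)
    have e2 := two_mul_card_edgeFinset (G := SimpleGraph.turanGraph n k)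
    rw [sum_card_nb_of_complete hadj, sum_sq_eq_of_balanced hGbal, ← Nat.cast_sum, hcsum] at e1
    rw [sum_card_nb_of_complete (turanGraph_adj_iff hk), sum_sq_eq_of_balanced hbal,
      ← Nat.cast_sum] at e2
    have : (#G.edgeFinset : ℝ) = #(SimpleGraph.turanGraph n k).edgeFinset := by linarith
    exact_mod_cast this
  have hmax : G.IsTuranMaximal k := by
    refine ⟨?_, fun H _ hH => ?_⟩
    · have hc : G.Colorable k := ⟨SimpleGraph.Coloring.mk col fun {u v} h => hcol u v h⟩
      exact hc.cliqueFree (Nat.lt_succ_self k)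
    · rw [hedge]
      exact (SimpleGraph.isTuranMaximal_turanGraph hk).2 hH
  have hiso := (SimpleGraph.isTuranMaximal_iff_nonempty_iso_turanGraph hk).1 hmax
  rwa [Fintype.card_fin] at hiso

end Turan

/-- A graph whose signless Laplacian radius is at least that of the Turán graph and all of whose
`k`-cliques have few common neighbours is the Turán graph. -/
theorem nonempty_iso_turanGraph_of_few_common_neighbors {k n : ℕ} (hk : 3 ≤ k) {ε : ℝ}
    (hε : ε = 1 / (24 * k ^ 3)) (hn : 16 * k / ε * Real.exp (6 / ε) < n)
    {G : SimpleGraph (Fin n)} [DecidableRel G.Adj]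
    (hq : signlessRadius (SimpleGraph.turanGraph n k) ≤ signlessRadius G)
    (hbook : ∀ B, G.IsNClique k B →
      (#(cnb G univ B) : ℝ) < Real.exp (-(6 / ε)) / (24 * k ^ 2) * n) :
    Nonempty (G ≃g SimpleGraph.turanGraph n k) := by
  have hk3 : (3 : ℝ) ≤ k := by exact_mod_cast hk
  have hk0 : (0 : ℝ) < k := by linarith
  have hkpos : 0 < k := by omega
  have hε0 : 0 < ε := by rw [hε]; positivity
  have hεk : ε * (24 * k ^ 3) = 1 := by rw [hε]; field_simp
  have hk27 : (27 : ℝ) ≤ k ^ 3 := by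
    calc (27 : ℝ) = 3 ^ 3 := by norm_num
      _ ≤ k ^ 3 := by gcongr
  have hε1 : ε ≤ 1 / 2 := by nlinarith
  have hexp : 1 ≤ Real.exp (6 / ε) := Real.one_le_exp (by positivity)
  have hn1 : 16 * k / ε < n := by
    refine lt_of_le_of_lt ?_ hn
    exact le_mul_of_one_le_right (by positivity) hexp
  have hn1' : 16 * k < n * ε := (div_lt_iff₀ hε0).1 hn1
  have hn0 : (0 : ℝ) < n := lt_of_le_of_lt (by positivity) hn1
  have hnpos : 0 < n := by exact_mod_cast hn0
  have hn96 : (96 : ℝ) ≤ n := by nlinarith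
  have : Nonempty (Fin n) := ⟨⟨0, hnpos⟩⟩
  have hcard : (#(univ : Finset (Fin n)) : ℝ) = n := by simp
  rw [← rad_univ, ← rad_univ (G := G)] at hq
  have hT := le_rad_turanGraph hnpos hkpos
  have hkn : 2 * (k : ℝ) / n ≤ ε / 8 := by
    rw [div_le_iff₀ hn0]; linarith
  have hinv : 1 / (k : ℝ) ≤ 1 / 3 := by gcongr
  have hTn : 5 / 4 * (n : ℝ) ≤ rad (SimpleGraph.turanGraph n k) univ := by nlinarith
  have hratio : 2 * (1 - 1 / (k : ℝ)) - 2 * k / n / n ≤ rad G univ / n := by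
    rw [le_div_iff₀ hn0, sub_mul, div_mul_cancel₀ _ hn0.ne']
    linarith
  have hG54 : 5 / 4 ≤ rad G univ / n := by
    rw [le_div_iff₀ hn0]; linarith
  obtain ⟨S, -, hS, hlog, hmono, hgain, hdeg⟩ :=
    exists_subset_large_minDegree (G := G) hε0 hε1 univ univ_nonempty (by rwa [hcard])
  rw [hcard] at hlog hmono hgain
  have hm0 : (0 : ℝ) < #S := by exact_mod_cast hS.card_pos
  have hrad2 : rad G S / #S ≤ 2 := by
    rw [div_le_iff₀ hm0]; exact rad_le_two_mul_card S
  have hmn : n * Real.exp (-(6 / ε)) ≤ #S := by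
    rw [← Real.log_le_log_iff (by positivity) hm0, Real.log_mul hn0.ne' (Real.exp_ne_zero _),
      Real.log_exp]
    have h1 : ε / 8 * Real.log n ≤ ε / 8 * (Real.log #S + 6 / ε) := by
      have : ε / 8 * (6 / ε) = 3 / 4 := by field_simp; norm_num
      linarith
    have := le_of_mul_le_mul_left h1 (by positivity)
    linarith
  have hmlarge : 16 / ε ≤ #S := by
    refine le_trans ?_ hmn
    have h1 : 16 / ε * Real.exp (6 / ε) ≤ n := by
      refine le_trans ?_ hn.le
      gcongr
      linarith
    rw [Real.exp_neg, ← div_eq_mul_inv, le_div_iff₀ (Real.exp_pos _)]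
    exact h1
  have hdeg := hdeg.resolve_left (not_lt.2 hmlarge)
  have hnn : 2 * (k : ℝ) / n / n ≤ 2 * ε := by
    rw [div_le_iff₀ hn0]
    nlinarith
  have hradS : (2 * (1 - 1 / (k : ℝ)) - 2 * ε) * #S ≤ rad G S :=
    (le_div_iff₀ hm0).1 (by linarith)
  obtain ⟨col, hcol⟩ : ∃ col : Fin n → Fin k, ∀ u ∈ S, ∀ v ∈ S, G.Adj u v → col u ≠ col v := by
    refine exists_coloring_of_minDegree hS (by omega) (e := #S / (12 * k ^ 2))
      (τ := #S / (24 * k ^ 2)) (by positivity) (by positivity) ?_ ?_ ?_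
    · have : (k : ℝ) * ((3 * k + 2) * (#S / (12 * k ^ 2)) + (6 * k + 3) * (#S / (24 * k ^ 2)))
          = (12 * k + 7) / (24 * k) * #S := by
        field_simp
        ring
      rw [this]
      refine mul_le_of_le_one_left hm0.le ?_
      rw [div_le_one (by positivity)]
      linarith
    · intro u hu
      have h1 := hdeg u hu
      rw [cast_card_sdiff (nb_subset S u)]
      have h2 : (1 - 1 / (k : ℝ) - 2 * ε) * #S ≤ #(nb G S u) := by linarith
      have h3 := mul_le_mul_of_nonneg_left h2 hk0.le
      have e1 : (k : ℝ) * ((1 - 1 / k - 2 * ε) * #S) = k * #S - #S - 2 * k * ε * #S := by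
        field_simp
      have e2 : #S / (12 * (k : ℝ) ^ 2) = 2 * k * ε * #S := by
        rw [hε]
        field_simp
        norm_num
      rw [e2]
      linarith
    · intro B _ hB
      have h1 : (#(cnb G S B) : ℝ) ≤ #(cnb G univ B) := by
        exact_mod_cast card_le_card (cnb_mono (subset_univ S) B)
      refine (h1.trans_lt (hbook B hB)).trans_le ?_
      rw [div_mul_eq_mul_div, mul_comm (Real.exp _)]
      gcongr
  rcases hgain with rfl | hgain
  · exact nonempty_iso_turanGraph_of_coloring hkpos
      (fun u v => hcol u (mem_univ u) v (mem_univ v)) (by linarith) hq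
  · exfalso
    have h1 := (div_le_iff₀ hm0).2 (rad_le_of_coloring (G := G) (by omega) hcol)
    have h2 : 2 * (k : ℝ) / n / n < ε / (8 * n) := by
      rw [div_div, div_lt_div_iff₀ (by positivity) (by positivity)]
      nlinarith
    linarith

end SignlessBook

theorem theorem2p10 (k : ℕ) (hk : 3 ≤ k) :
    ∃ c : ℝ, 0 < c ∧ ∃ n₀ : ℕ, ∀ n : ℕ, n₀ ≤ n →
      ∀ (G : SimpleGraph (Fin n)) [DecidableRel G.Adj],
        SignlessBook.signlessRadius (SimpleGraph.turanGraph n k) ≤ SignlessBook.signlessRadius G →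
        ¬ Nonempty (G ≃g SimpleGraph.turanGraph n k) →
        ∃ t : ℕ, c * (n : ℝ) ≤ (t : ℝ) ∧
          SimpleGraph.IsContained (SignlessBook.generalizedBook k t) G := by
  have hk0 : (0 : ℝ) < k := by positivity
  obtain ⟨ε, hε⟩ : ∃ ε : ℝ, ε = 1 / (24 * k ^ 3) := ⟨_, rfl⟩
  obtain ⟨n₀, hn₀⟩ := exists_nat_gt (16 * k / ε * Real.exp (6 / ε))
  refine ⟨Real.exp (-(6 / ε)) / (24 * k ^ 2), by positivity, n₀, fun n hn G _ hq hiso => ?_⟩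
  by_contra! hno
  refine hiso (SignlessBook.nonempty_iso_turanGraph_of_few_common_neighbors hk hε
    (hn₀.trans_le (by exact_mod_cast hn)) hq fun B hB => ?_)
  by_contra! hle
  exact not_isEmpty_iff.2 (SignlessBook.generalizedBook_isContained hB Finset.univ) (hno _ hle)
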